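/- Let $P\ge 1$ and $K\ge 0$ be integers. A channel assigns to every input word $\mathbf x$ a probability distribution on output words. A code of length $n$ is a nonempty set $\mathcal C$ of input words of length $n$; it is zero-error if no two distinct codewords can produce the same output word with positive probability, and optimal if it is zero-error and has the largest cardinality among zero-error codes of length $n$. The rate of $\mathcal C$ is $\frac{1}{L_{\mathrm{av}}}\log_2|\mathcal C|$, where $L_{\mathrm{av}}$ is the average length of the output word (over equiprobable codewords and the channel statistics), and the zero-error capacity is the $\limsup_{n\to\infty}$ of the rates of optimal zero-error codes of length $n$. The shift channel with parameters $P,K$ has as inputs words $\mathbf x=(x_1,\dots,x_n)$ over $\{0,1,\dots,P\}$ (with $0$ an empty cell and $p\ge 1$ a particle of type $p$). Its possible outputs, each occurring with positive probability, are exactly the words $\mathbf z=(z_1,\dots,z_{n+K})$ over $\{0,1,\dots,P\}$ with the same subsequence of nonzero symbols, in which the position $j_l$ of the $l$-th nonzero symbol satisfies $0\le j_l-i_l\le K$ for every $l$, where $i_l$ is its position in $\mathbf x$. The Hamming weight of a word is its number of nonzero symbols; $\tilde{\mathbf x}$ denotes the word obtained from $\mathbf x$ by deleting the zeros, and $\underline{\mathbf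 x}$ the binary indicator word of the nonzero positions of $\mathbf x$. Given a discrete memoryless channel (DMC) with input alphabet $\{1,\dots,P\}$, output alphabet not containing $0$, and zero-error capacity $C_0$, the noisy shift channel first passes $\mathbf x$ through the shift channel and then passes the subsequence of nonzero symbols through the DMC, independently of the shifts. **Theorem.** 1. The equation $x^{K+1}-2^{C_0}x^K-1=0$ has a unique positive solution $r$, and the zero-error capacity of the noisy shift channel equals $\log_2 r$. 2. Let $\mathcal C^{\mathrm N}(w)$ be an optimal zero-error code of length $w$ for the DMC, and let $\mathcal C_{1;K}(n,w)$ be a largest zero-error code of length $n$ with all codewords of weight $w$ for the shift channel with parameters $1,K$. Then $$\{\mathbf x\in\{0,\dots,P\}^n:\ \tilde{\mathbf x}\in\mathcal C^{\mathrm N}(w),\ \underline{\mathbf x}\in\mathcal C_{1;K}(n,w)\}$$ is a largest zero-error code of length $n$ with all codewords of weight $w$ for the noisy shift channel. For every $n$ and every choice of such codes for $w=0,1,\dots,n$, the union of these product codes over $w=0,\dots,n$ is an optimal zero-error code of length $n$ for the noisy shift channel. -/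

import Mathlib

open Filter
open scoped ENNReal

/-- A channel whose inputs are words over `A` and whose outputs are words over `B` (possibly of a
different, random length): to every input word it assigns the law of the output word. -/
abbrev Channel (A B : Type*) := List A → PMF (List B)

namespace Channel

variable {A B : Type*}

/-- `ch.Produces x z`: the output `z` has positive probability when `x` is transmitted. -/
def Produces (ch : Channel A B) (x : List A) (z : List B) : Prop := z ∈ (ch x).support

/-- A zero-error code of length `n`: a nonempty set of input words of length `n`, no two distinct
ones of which can produce the same output. -/
def IsZeroErrorCode (ch : Channel A B) (n : ℕ) (C : Finset (List A)) : Prop :=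
  C.Nonempty ∧ (∀ x ∈ C, x.length = n) ∧
    ∀ x ∈ C, ∀ y ∈ C, x ≠ y → ∀ z, ¬ (ch.Produces x z ∧ ch.Produces y z)

/-- A zero-error code of length `n` of the largest possible cardinality. -/
def IsOptimalCode (ch : Channel A B) (n : ℕ) (C : Finset (List A)) : Prop :=
  ch.IsZeroErrorCode n C ∧ ∀ D, ch.IsZeroErrorCode n D → D.card ≤ C.card

/-- The average length of the channel output, over the (equiprobable) codewords of `C` and over
the channel statistics. -/
noncomputable def avgOutputLength (ch : Channel A B) (C : Finset (List A)) : ℝ≥0∞ :=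
  (∑ x ∈ C, ∑' z : List B, (z.length : ℝ≥0∞) * ch x z) / C.card

/-- The rate of a code, in bits per output symbol. -/
noncomputable def rate (ch : Channel A B) (C : Finset (List A)) : ℝ :=
  Real.logb 2 C.card / (ch.avgOutputLength C).toReal

/-- The zero-error capacity: the `limsup`, as the length `n` tends to infinity, of the rates of
optimal zero-error codes of length `n`. (Should optimal codes of the same length have different
rates, the best one counts.) -/
noncomputable def zeroErrorCapacity (ch : Channel A B) : EReal :=
  limsup (fun n : ℕ => ⨆ (C : Finset (List A)) (_ : ch.IsOptimalCode n C),
    ((ch.rate C : ℝ) : EReal)) atTop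

end Channel

/-- The memoryless channel with transition probabilities `W`: every letter `a` of the input word
is replaced by a letter of law `W a`, independently of the other letters. -/
noncomputable def memoryless {A B : Type*} (W : A → PMF B) : Channel A B
  | [] => PMF.pure []
  | a :: x => (W a).bind fun b => (memoryless W x).map (b :: ·)

/-! The state of a register with particles of types in `X` is a word over `Option X`: the letter
`none` is an empty cell (the symbol `0`) and `some p` is a cell with a particle of type `p`. -/

/-- The (increasing) list of the positions of the nonempty cells. -/
def particlePositions {X : Type*} : List (Option X) → List ℕ
  | [] => []
  | none :: x => (particlePositions x).map (· + 1)
  | some _ :: x => 0 :: (particlePositions x).map (· + 1)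

/-- The word obtained by deleting all the empty cells. -/
def particleTypes {X : Type*} (x : List (Option X)) : List X := x.reduceOption

/-- The number of nonempty cells. -/
def hammingWeight {X : Type*} (x : List (Option X)) : ℕ := (particleTypes x).length

/-- The indicator sequence, in which all particles have the same type. -/
def indicatorWord {X : Type*} (x : List (Option X)) : List (Option (Fin 1)) :=
  x.map (Option.map fun _ => 0)

/-- The register `x` can turn into `z` when every particle is shifted by at least `0` and at most
`K` cells to the right, without particles swapping or sharing cells; the register is extended by
`K` cells on the right. -/
def ShiftsTo {X : Type*} (K : ℕ) (x z : List (Option X)) : Prop :=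
  z.length = x.length + K ∧ particleTypes x = particleTypes z ∧
    List.Forall₂ (fun i j => i ≤ j ∧ j ≤ i + K) (particlePositions x) (particlePositions z)

/-- `S` is a shift channel with parameter `K`: the outputs of positive probability on input `x`
are exactly the words that `x` can turn into. -/
def IsShiftChannel {X : Type*} (K : ℕ) (S : Channel (Option X) (Option X)) : Prop :=
  ∀ x z, S.Produces x z ↔ ShiftsTo K x z

/-- The noise of one cell: an empty cell is not affected, and a particle of type `p` becomes one
of a random type with law `W p`. -/
noncomputable def particleNoise {X Y : Type*} (W : X → PMF Y) : Option X → PMF (Option Y)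
  | none => PMF.pure none
  | some p => (W p).map some

/-- The noisy shift channel: the particles are shifted by `S`, and their types are transmitted
over the discrete memoryless channel `W`, independently of the shifts. -/
noncomputable def noisyShift {X Y : Type*} (S : Channel (Option X) (Option X)) (W : X → PMF Y) :
    Channel (Option X) (Option Y) :=
  fun x => (S x).bind (memoryless (particleNoise W))

/-- A zero-error code of length `n`, all of whose codewords have weight `w`, and of the largest
cardinality among such codes. -/
def IsOptimalCodeOfWeight {X B : Type*} (ch : Channel (Option X) B) (n w : ℕ)
    (C : Finset (List (Option X))) : Prop :=
  (ch.IsZeroErrorCode n C ∧ ∀ x ∈ C, hammingWeight x = w) ∧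
    ∀ D, ch.IsZeroErrorCode n D → (∀ x ∈ D, hammingWeight x = w) → D.card ≤ C.card

open Classical in
/-- The product of a code `T` for the particle types and a code `I` for the particle positions:
the words of length `n` with sequence of types in `T` and indicator sequence in `I`. -/
noncomputable def productCode {X : Type*} [Finite X] (n : ℕ) (T : Finset (List X))
    (I : Finset (List (Option (Fin 1)))) : Finset (List (Option X)) :=
  (List.finite_length_eq (Option X) n).toFinset.filter
    fun x => particleTypes x ∈ T ∧ indicatorWord x ∈ I

/-!
Two input words of the same length are confusable for the noisy shift channel iff their type
sequences are confusable for the memoryless channel and their lists of positions differ by at most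
`K` in every entry (`noisyShift_confusable_iff`): in that case the entrywise maximum of the two
position lists is an increasing list that both can be shifted to.

Let `i_k` be the position of the `k`-th particle. Then `i_k - k` is nondecreasing in `k`, and
replacing it by `⌊(i_k - k) / (K + 1)⌋` (`compress`) sorts the words of length `n` and weight `w`
into `(w + ⌊(n - w) / (K + 1)⌋).choose w` classes, within which positions are never
distinguishable. Multiplying by `K + 1` instead (`stretch`) gives one word in each class such that
these words are pairwise distinguishable. Hence an optimal code of weight `w` for the shift channel
with one type of particles has exactly that many words (`IsOptimalCodeOfWeight.card_eq`). In a code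
for the noisy channel, the words of one class have distinct type sequences, and these form a
zero-error code for the memoryless channel (`card_le_of_isZeroErrorCode_noisyShift`). This proves
that product codes are optimal. The weight is preserved by the channel, so that optimal codes for
the different weights can be united.

Optimal codes of length `n` thus have `∑ w ≤ n, a w * (w + ⌊(n - w) / (K + 1)⌋).choose w` words
(`productUnionCard`), where `a w` is the size of optimal codes for the memoryless channel. For
`s > 1` put `c = s - s⁻ᴷ`, so that `c / s + s⁻ᴷ⁻¹ = 1`. By the binomial theorem all the numbers
`(w + m).choose w * c ^ w` are at most `s ^ (w + (K + 1) * m)`, and some of those with `w + m = N`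
reach this bound up to the factor `N + 1`. The root `r` is the value of `s` with `c = 2 ^ C₀`. If
`s > r`, then `a w` is at most a constant times `c ^ w`, and if `s < r`, it is at least a constant
times `c ^ w`; the latter holds for all `w`, not only infinitely many, because `a` is
supermultiplicative by concatenation of codes. Hence the sum grows like `r ^ n` to within
arbitrarily small exponential factors (`limsup_productUnionCard`).
-/

/-! ### Increasing lists of positions -/

/-- Two lists of positions have the same length and differ by at most `K` in every entry. -/
def Near (K : ℕ) : List ℕ → List ℕ → Prop :=
  List.Forall₂ fun i j => i ≤ j + K ∧ j ≤ i + K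

/-- The quantisation of a list of positions: the number `i - k` of empty cells in front of the
`k`-th particle is divided by `K + 1` and rounded down. -/
def compress (K : ℕ) (l : List ℕ) : List ℕ := l.mapIdx fun k i => k + (i - k) / (K + 1)

/-- The section of `compress`: every empty cell is replaced by `K + 1` empty cells. -/
def stretch (K : ℕ) (l : List ℕ) : List ℕ := l.mapIdx fun k i => k + (K + 1) * (i - k)

@[simp] theorem length_compress (K : ℕ) (l : List ℕ) : (compress K l).length = l.length := by
  simp [compress]

@[simp] theorem length_stretch (K : ℕ) (l : List ℕ) : (stretch K l).length = l.length := by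
  simp [stretch]

theorem near_iff_getElem {K : ℕ} {l l' : List ℕ} :
    Near K l l' ↔ l.length = l'.length ∧
      ∀ k (h : k < l.length) (h' : k < l'.length), l[k] ≤ l'[k] + K ∧ l'[k] ≤ l[k] + K := by
  simp [Near, List.forall₂_iff_get]

/-- The number `l[i] - i` of empty cells in front of the `i`-th particle is nondecreasing in `i`. -/
theorem gap_le_gap {l : List ℕ} (hl : l.Pairwise (· < ·)) {i j : ℕ} (hij : i ≤ j)
    (hj : j < l.length) : l[i] + j ≤ l[j] + i := by
  induction j, hij using Nat.le_induction with
  | base => rfl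
  | succ j hij ih =>
    have h1 := ih (by omega)
    have h2 := List.pairwise_iff_getElem.1 hl j (j + 1) (by omega) hj (by omega)
    omega

theorem index_le_getElem {l : List ℕ} (hl : l.Pairwise (· < ·)) {k : ℕ} (hk : k < l.length) :
    k ≤ l[k] := by
  have := gap_le_gap hl (Nat.zero_le k) hk
  omega

theorem getElem_add_length_le {l : List ℕ} (hl : l.Pairwise (· < ·)) {n : ℕ}
    (hn : ∀ i ∈ l, i < n) {k : ℕ} (hk : k < l.length) : l[k] + l.length ≤ n + k := by
  have h1 := gap_le_gap hl (show k ≤ l.length - 1 by omega) (by omega)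
  have h2 := hn _ (List.getElem_mem (l := l) (n := l.length - 1) (by omega))
  omega

theorem pairwise_compress (K : ℕ) {l : List ℕ} (hl : l.Pairwise (· < ·)) :
    (compress K l).Pairwise (· < ·) := by
  rw [List.pairwise_iff_getElem]
  intro i j hi hj hij
  rw [length_compress] at hi hj
  have h1 := gap_le_gap hl hij.le hj
  have h2 : (l[i] - i) / (K + 1) ≤ (l[j] - j) / (K + 1) := Nat.div_le_div_right (by omega)
  simp only [compress, List.getElem_mapIdx]
  omega

theorem lt_of_mem_compress (K : ℕ) {l : List ℕ} (hl : l.Pairwise (· < ·)) {n : ℕ}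
    (hn : ∀ i ∈ l, i < n) : ∀ i ∈ compress K l, i < l.length + (n - l.length) / (K + 1) := by
  intro i hi
  obtain ⟨k, hk, rfl⟩ := List.getElem_of_mem hi
  rw [length_compress] at hk
  have h1 := getElem_add_length_le hl hn hk
  have h2 : (l[k] - k) / (K + 1) ≤ (n - l.length) / (K + 1) := Nat.div_le_div_right (by omega)
  simp only [compress, List.getElem_mapIdx]
  omega

theorem near_of_compress_eq {K : ℕ} {l l' : List ℕ} (hl : l.Pairwise (· < ·))
    (hl' : l'.Pairwise (· < ·)) (h : compress K l = compress K l') : Near K l l' := by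
  have hlen : l.length = l'.length := by simpa using congrArg List.length h
  refine near_iff_getElem.2 ⟨hlen, fun k hk hk' => ?_⟩
  have h0 : (compress K l)[k]'(by simpa) = (compress K l')[k]'(by simpa) := by simp only [h]
  simp only [compress, List.getElem_mapIdx] at h0
  have h1 := index_le_getElem hl hk
  have h2 := index_le_getElem hl' hk'
  have h3 := Nat.div_add_mod (l[k] - k) (K + 1)
  have h4 := Nat.div_add_mod (l'[k] - k) (K + 1)
  have h5 := Nat.mod_lt (l[k] - k) (Nat.succ_pos K)
  have h6 := Nat.mod_lt (l'[k] - k) (Nat.succ_pos K)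
  rw [Nat.add_left_cancel h0] at h3
  simp only [Nat.succ_eq_add_one] at h5 h6
  omega

theorem pairwise_stretch (K : ℕ) {l : List ℕ} (hl : l.Pairwise (· < ·)) :
    (stretch K l).Pairwise (· < ·) := by
  rw [List.pairwise_iff_getElem]
  intro i j hi hj hij
  rw [length_stretch] at hi hj
  have h1 := gap_le_gap hl hij.le hj
  have h2 : (K + 1) * (l[i] - i) ≤ (K + 1) * (l[j] - j) := Nat.mul_le_mul_left _ (by omega)
  simp only [stretch, List.getElem_mapIdx]
  omega

theorem lt_of_mem_stretch (K : ℕ) {l : List ℕ} (hl : l.Pairwise (· < ·)) {m : ℕ}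
    (hm : ∀ i ∈ l, i < l.length + m) : ∀ i ∈ stretch K l, i < l.length + (K + 1) * m := by
  intro i hi
  obtain ⟨k, hk, rfl⟩ := List.getElem_of_mem hi
  rw [length_stretch] at hk
  have h1 := getElem_add_length_le hl hm hk
  have h2 : (K + 1) * (l[k] - k) ≤ (K + 1) * m := Nat.mul_le_mul_left _ (by omega)
  simp only [stretch, List.getElem_mapIdx]
  omega

theorem eq_of_near_stretch {K : ℕ} {l l' : List ℕ} (hl : l.Pairwise (· < ·))
    (hl' : l'.Pairwise (· < ·)) (h : Near K (stretch K l) (stretch K l')) : l = l' := by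
  obtain ⟨hlen, h⟩ := near_iff_getElem.1 h
  simp only [length_stretch] at hlen
  refine List.ext_getElem hlen fun k hk hk' => ?_
  have h0 := h k (by simpa) (by simpa)
  simp only [stretch, List.getElem_mapIdx] at h0
  have h1 := index_le_getElem hl hk
  have h2 := index_le_getElem hl' hk'
  have h3 : l[k] - k = l'[k] - k := by
    rcases lt_trichotomy (l[k] - k) (l'[k] - k) with hlt | heq | hlt
    · have := Nat.mul_le_mul_left (K + 1) (Nat.succ_le_of_lt hlt)
      rw [Nat.mul_succ] at this
      omega
    · exact heq
    · have := Nat.mul_le_mul_left (K + 1) (Nat.succ_le_of_lt hlt)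
      rw [Nat.mul_succ] at this
      omega
  omega

/-- The increasing lists of `w` natural numbers below `N`. -/
noncomputable def increasingLists (N w : ℕ) : Finset (List ℕ) :=
  ((Finset.range N).powersetCard w).map
    ⟨fun s => s.sort (· ≤ ·), fun s t h => by
      simpa using congrArg List.toFinset h⟩

theorem card_increasingLists (N w : ℕ) : (increasingLists N w).card = N.choose w := by
  simp [increasingLists]

theorem mem_increasingLists {N w : ℕ} {l : List ℕ} :
    l ∈ increasingLists N w ↔ l.Pairwise (· < ·) ∧ l.length = w ∧ ∀ i ∈ l, i < N := by
  simp only [increasingLists, Finset.mem_map, Finset.mem_powersetCard]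
  constructor
  · rintro ⟨s, ⟨hs, hw⟩, rfl⟩
    change (s.sort (· ≤ ·)).Pairwise (· < ·) ∧ (s.sort (· ≤ ·)).length = w ∧
      ∀ i ∈ s.sort (· ≤ ·), i < N
    refine ⟨(Finset.sortedLT_sort s).pairwise, by simpa using hw, fun i hi => ?_⟩
    simpa using hs (by simpa using hi)
  · rintro ⟨hl, hw, hN⟩
    have hnd : l.Nodup := hl.imp fun h => h.ne
    refine ⟨l.toFinset, ⟨fun i hi => by simpa using hN i (by simpa using hi), ?_⟩, ?_⟩
    · rw [List.toFinset_card_of_nodup hnd, hw]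
    · exact (List.toFinset_sort (· ≤ ·) hnd).2 (hl.imp fun h => h.le)

/-- Two increasing lists of positions are near each other when both can be shifted to the right by
at most `K` to a common increasing list, namely their entrywise maximum. -/
theorem exists_common_shift {K n : ℕ} {l l' : List ℕ} (hl : l.Pairwise (· < ·))
    (hl' : l'.Pairwise (· < ·)) (hn : ∀ i ∈ l, i < n) (hn' : ∀ i ∈ l', i < n) (h : Near K l l') :
    ∃ b : List ℕ, b.Pairwise (· < ·) ∧ (∀ i ∈ b, i < n + K) ∧
      List.Forall₂ (fun i j => i ≤ j ∧ j ≤ i + K) l b ∧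
      List.Forall₂ (fun i j => i ≤ j ∧ j ≤ i + K) l' b := by
  obtain ⟨hlen, h⟩ := near_iff_getElem.1 h
  refine ⟨List.zipWith max l l', ?_, ?_, ?_, ?_⟩
  · rw [List.pairwise_iff_getElem]
    intro i j hi hj hij
    simp only [List.length_zipWith] at hi hj
    have h1 := List.pairwise_iff_getElem.1 hl i j (by omega) (by omega) hij
    have h2 := List.pairwise_iff_getElem.1 hl' i j (by omega) (by omega) hij
    simp only [List.getElem_zipWith]
    omega
  · intro i hi
    obtain ⟨k, hk, rfl⟩ := List.getElem_of_mem hi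
    simp only [List.length_zipWith] at hk
    have h1 := hn _ (List.getElem_mem (l := l) (n := k) (by omega))
    have h2 := hn' _ (List.getElem_mem (l := l') (n := k) (by omega))
    simp only [List.getElem_zipWith]
    omega
  · rw [List.forall₂_iff_get]
    refine ⟨by simp [hlen], fun k hk hk' => ?_⟩
    have := h k hk (by omega)
    simp only [List.get_eq_getElem, List.getElem_zipWith]
    omega
  · rw [List.forall₂_iff_get]
    refine ⟨by simp [hlen], fun k hk hk' => ?_⟩
    have := h k (by omega) hk
    simp only [List.get_eq_getElem, List.getElem_zipWith]
    omega

theorem near_of_common_shift {K : ℕ} {l l' b : List ℕ}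
    (h : List.Forall₂ (fun i j => i ≤ j ∧ j ≤ i + K) l b)
    (h' : List.Forall₂ (fun i j => i ≤ j ∧ j ≤ i + K) l' b) : Near K l l' := by
  rw [List.forall₂_iff_get] at h h'
  refine near_iff_getElem.2 ⟨h.1.trans h'.1.symm, fun k hk hk' => ?_⟩
  have h1 := h.2 k hk (h.1 ▸ hk)
  have h2 := h'.2 k hk' (h.1 ▸ hk)
  simp only [List.get_eq_getElem] at h1 h2
  omega

/-! ### Words, their types and their positions -/

section Words

variable {X Y : Type*}

@[simp] theorem particleTypes_nil : particleTypes ([] : List (Option X)) = [] := rfl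

@[simp] theorem particleTypes_none (x : List (Option X)) :
    particleTypes (none :: x) = particleTypes x := rfl

@[simp] theorem particleTypes_some (p : X) (x : List (Option X)) :
    particleTypes (some p :: x) = p :: particleTypes x := rfl

theorem length_particlePositions (x : List (Option X)) :
    (particlePositions x).length = (particleTypes x).length := by
  induction x with
  | nil => rfl
  | cons a x ih => cases a <;> simp [particlePositions, ih]

theorem pairwise_particlePositions (x : List (Option X)) :
    (particlePositions x).Pairwise (· < ·) := by
  induction x with
  | nil => simp [particlePositions]
  | cons a x ih => cases a <;> simp [particlePositions, List.pairwise_map, ih]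

theorem lt_of_mem_particlePositions (x : List (Option X)) :
    ∀ i ∈ particlePositions x, i < x.length := by
  induction x with
  | nil => simp [particlePositions]
  | cons a x ih => cases a <;> simpa [particlePositions] using ih

theorem hammingWeight_le_length (x : List (Option X)) : hammingWeight x ≤ x.length :=
  List.reduceOption_length_le x

theorem word_ext {x y : List (Option X)} (hlen : x.length = y.length)
    (hp : particlePositions x = particlePositions y) (ht : particleTypes x = particleTypes y) :
    x = y := by
  have hinj : Function.Injective (fun l : List ℕ => l.map (· + 1)) :=
    List.map_injective_iff.2 (add_left_injective 1)
  induction x generalizing y with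
  | nil => simpa using hlen.symm
  | cons a x ih =>
    cases y with
    | nil => simp at hlen
    | cons b y =>
      simp only [List.length_cons, Nat.add_right_cancel_iff] at hlen
      cases a <;> cases b
      · rw [ih hlen (hinj hp) ht]
      · have : (0 : ℕ) ∈ (particlePositions x).map (· + 1) := by
          rw [show (particlePositions x).map (· + 1) = _ from hp]; simp [particlePositions]
        simp at this
      · have : (0 : ℕ) ∈ (particlePositions y).map (· + 1) := by
          rw [← show _ = (particlePositions y).map (· + 1) from hp]; simp [particlePositions]
        simp at this
      · simp only [particleTypes_some, List.cons.injEq] at ht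
        simp only [particlePositions, List.cons.injEq, true_and] at hp
        rw [ih hlen (hinj hp) ht.2, ht.1]

/-- There is a word with any prescribed positions and types of the particles. -/
theorem exists_word {N : ℕ} {b : List ℕ} (hb : b.Pairwise (· < ·)) (hN : ∀ i ∈ b, i < N)
    {t : List X} (ht : t.length = b.length) :
    ∃ z : List (Option X), z.length = N ∧ particlePositions z = b ∧ particleTypes z = t := by
  -- Positions that avoid the first cell come from positions in the remaining cells.
  have key : ∀ (M : ℕ) (c : List ℕ), c.Pairwise (· < ·) → (∀ i ∈ c, 1 ≤ i ∧ i < M + 1) →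
      ∃ c' : List ℕ, c = c'.map (· + 1) ∧ c'.Pairwise (· < ·) ∧ ∀ i ∈ c', i < M := by
    intro M c hc hM
    have h1 : c = (c.map (· - 1)).map (· + 1) := by
      rw [List.map_map]
      conv_lhs => rw [← List.map_id c]
      refine List.map_congr_left fun i hi => ?_
      have := hM i hi
      simp only [id, Function.comp]
      omega
    refine ⟨c.map (· - 1), h1, ?_, ?_⟩
    · rw [h1, List.pairwise_map] at hc
      exact hc.imp fun h => by omega
    · intro i hi
      obtain ⟨j, hj, rfl⟩ := List.mem_map.1 hi
      have := hM j hj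
      omega
  induction N generalizing b t with
  | zero =>
    have : b = [] := List.eq_nil_iff_forall_not_mem.2 fun i hi => by simpa using hN i hi
    subst this
    exact ⟨[], rfl, rfl, (List.length_eq_zero_iff.1 ht).symm⟩
  | succ N ih =>
    by_cases h0 : 0 ∈ b
    · cases b with
      | nil => simp at h0
      | cons i b =>
        rw [List.pairwise_cons] at hb
        have hi : i = 0 := by
          rcases List.mem_cons.1 h0 with h | h
          · exact h.symm
          · exact absurd (hb.1 0 h) (Nat.not_lt_zero i)
        subst hi
        cases t with
        | nil => simp at ht
        | cons p t =>
          obtain ⟨c, rfl, hc, hcN⟩ := key N b hb.2 fun i hi =>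
            ⟨hb.1 i hi, hN i (List.mem_cons_of_mem _ hi)⟩
          obtain ⟨z, hz1, hz2, hz3⟩ := ih hc hcN (t := t) (by simpa using ht)
          exact ⟨some p :: z, by simp [hz1], by simp [particlePositions, hz2], by simp [hz3]⟩
    · obtain ⟨c, rfl, hc, hcN⟩ := key N b hb fun i hi =>
        ⟨Nat.one_le_iff_ne_zero.2 fun h => h0 (h ▸ hi), hN i hi⟩
      obtain ⟨z, hz1, hz2, hz3⟩ := ih hc hcN (t := t) (by simpa using ht)
      exact ⟨none :: z, by simp [hz1], by simp [particlePositions, hz2], by simp [hz3]⟩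

theorem particlePositions_indicatorWord (x : List (Option X)) :
    particlePositions (indicatorWord x) = particlePositions x := by
  unfold indicatorWord
  induction x with
  | nil => rfl
  | cons a x ih => cases a <;> simp [particlePositions, ih]

theorem length_indicatorWord (x : List (Option X)) : (indicatorWord x).length = x.length := by
  simp [indicatorWord]

theorem hammingWeight_eq_length_particlePositions (x : List (Option X)) :
    hammingWeight x = (particlePositions x).length := (length_particlePositions x).symm

theorem hammingWeight_indicatorWord (x : List (Option X)) :
    hammingWeight (indicatorWord x) = hammingWeight x := by
  simp only [hammingWeight_eq_length_particlePositions, particlePositions_indicatorWord]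

theorem binary_word_ext {x y : List (Option (Fin 1))} (hlen : x.length = y.length)
    (hp : particlePositions x = particlePositions y) : x = y := by
  refine word_ext hlen hp (List.ext_getElem ?_ fun _ _ _ => Subsingleton.elim _ _)
  rw [← length_particlePositions, hp, length_particlePositions]

/-! ### Confusable words -/

/-- Two input words are confusable when they can produce the same output. -/
def Channel.Confusable {A B : Type*} (ch : Channel A B) (x y : List A) : Prop :=
  ∃ z, ch.Produces x z ∧ ch.Produces y z

theorem Channel.isZeroErrorCode_iff {A B : Type*} {ch : Channel A B} {n : ℕ}
    {C : Finset (List A)} : ch.IsZeroErrorCode n C ↔ C.Nonempty ∧ (∀ x ∈ C, x.length = n) ∧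
      ∀ x ∈ C, ∀ y ∈ C, ch.Confusable x y → x = y := by
  refine and_congr_right fun _ => and_congr_right fun _ => ?_
  refine forall₂_congr fun x _ => forall₂_congr fun y _ => ?_
  rw [← not_imp_not, Channel.Confusable, not_forall_not, not_not]

theorem memoryless_produces_iff {A B : Type*} (W : A → PMF B) (x : List A) (z : List B) :
    (memoryless W).Produces x z ↔ List.Forall₂ (fun a b => b ∈ (W a).support) x z := by
  unfold Channel.Produces
  induction x generalizing z with
  | nil => simp [memoryless]
  | cons a x ih =>
    simp only [memoryless, PMF.mem_support_bind_iff, PMF.mem_support_map_iff, ih,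
      List.forall₂_cons_left_iff]
    aesop

theorem forall₂_particleNoise {W : X → PMF Y} {y : List (Option X)} {z : List (Option Y)}
    (h : List.Forall₂ (fun a b => b ∈ (particleNoise W a).support) y z) :
    particlePositions y = particlePositions z ∧ y.length = z.length ∧
      List.Forall₂ (fun a b => b ∈ (W a).support) (particleTypes y) (particleTypes z) := by
  induction h with
  | nil => simp [particlePositions]
  | @cons a b y z hab _ ih =>
    cases a with
    | none =>
      obtain rfl : b = none := by simpa [particleNoise] using hab
      simpa [particlePositions, ih.1] using ih.2
    | some p =>
      obtain ⟨q, hq, rfl⟩ : ∃ q, q ∈ (W p).support ∧ some q = b := by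
        simpa [particleNoise] using hab
      simp only [particlePositions, ih.1, particleTypes_some, List.forall₂_cons,
        List.length_cons, ih.2.1, true_and]
      exact ⟨hq, ih.2.2⟩

theorem exists_forall₂_particleNoise {W : X → PMF Y} {z : List (Option Y)} {t : List X}
    (h : List.Forall₂ (fun a b => b ∈ (W a).support) t (particleTypes z)) :
    ∃ y, particleTypes y = t ∧
      List.Forall₂ (fun a b => b ∈ (particleNoise W a).support) y z := by
  induction z generalizing t with
  | nil => exact ⟨[], (List.forall₂_nil_right_iff.1 h).symm, .nil⟩
  | cons b z ih =>
    cases b with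
    | none =>
      obtain ⟨y, rfl, hy⟩ := ih h
      exact ⟨none :: y, rfl, .cons (by simp [particleNoise]) hy⟩
    | some q =>
      rw [particleTypes_some, List.forall₂_cons_right_iff] at h
      obtain ⟨p, t, hp, ht, rfl⟩ := h
      obtain ⟨y, rfl, hy⟩ := ih ht
      refine ⟨some p :: y, rfl, .cons ?_ hy⟩
      rw [particleNoise, PMF.mem_support_map_iff]
      exact ⟨q, hp, rfl⟩

/-- The word between the shifts and the noise is eliminated: the noise changes neither the positions
nor the length, and acts on the type sequence as the memoryless channel. -/
theorem noisyShift_produces_iff {K : ℕ} {S : Channel (Option X) (Option X)}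
    (hS : IsShiftChannel K S) (W : X → PMF Y) (x : List (Option X)) (z : List (Option Y)) :
    (noisyShift S W).Produces x z ↔ z.length = x.length + K ∧
      (memoryless W).Produces (particleTypes x) (particleTypes z) ∧
      List.Forall₂ (fun i j => i ≤ j ∧ j ≤ i + K) (particlePositions x) (particlePositions z) := by
  rw [memoryless_produces_iff]
  have h1 : (noisyShift S W).Produces x z ↔
      ∃ y, ShiftsTo K x y ∧ (memoryless (particleNoise W)).Produces y z := by
    simp only [← hS x, Channel.Produces, noisyShift, PMF.mem_support_bind_iff]
  simp only [h1, memoryless_produces_iff]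
  constructor
  · rintro ⟨y, ⟨hlen, ht, hp⟩, hyz⟩
    obtain ⟨h2, h3, h4⟩ := forall₂_particleNoise hyz
    exact ⟨h3 ▸ hlen, ht ▸ h4, h2 ▸ hp⟩
  · rintro ⟨hlen, ht, hp⟩
    obtain ⟨y, hy, hyz⟩ := exists_forall₂_particleNoise ht
    obtain ⟨h2, h3, -⟩ := forall₂_particleNoise hyz
    exact ⟨y, ⟨h3 ▸ hlen, hy.symm, h2 ▸ hp⟩, hyz⟩

/-- The shifts and the type noise act separately: two words are confusable for the noisy shift
channel iff their type sequences are confusable for the memoryless channel and their positions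
are near each other. -/
theorem noisyShift_confusable_iff {K : ℕ} {S : Channel (Option X) (Option X)}
    (hS : IsShiftChannel K S) (W : X → PMF Y) {x y : List (Option X)}
    (hxy : x.length = y.length) :
    (noisyShift S W).Confusable x y ↔
      (memoryless W).Confusable (particleTypes x) (particleTypes y) ∧
      Near K (particlePositions x) (particlePositions y) := by
  simp only [Channel.Confusable, noisyShift_produces_iff hS]
  constructor
  · rintro ⟨z, ⟨-, hx, hxz⟩, -, hy, hyz⟩
    exact ⟨⟨_, hx, hy⟩, near_of_common_shift hxz hyz⟩
  · rintro ⟨⟨u, hx, hy⟩, h⟩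
    obtain ⟨b, hb, hbn, hxb, hyb⟩ := exists_common_shift (pairwise_particlePositions x)
      (pairwise_particlePositions y) (lt_of_mem_particlePositions x)
      (hxy ▸ lt_of_mem_particlePositions y) h
    obtain ⟨z, hz, rfl, rfl⟩ := exists_word (t := u) hb hbn (by
      rw [← ((memoryless_produces_iff _ _ _).1 hx).length_eq, ← hxb.length_eq,
        length_particlePositions])
    exact ⟨z, ⟨hz, hx, hxb⟩, hxy ▸ hz, hy, hyb⟩

theorem shift_confusable_iff {K : ℕ} {S : Channel (Option X) (Option X)}
    (hS : IsShiftChannel K S) {x y : List (Option X)} (hxy : x.length = y.length) :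
    S.Confusable x y ↔ particleTypes x = particleTypes y ∧
      Near K (particlePositions x) (particlePositions y) := by
  unfold Channel.Confusable
  simp only [hS _ _, ShiftsTo]
  constructor
  · rintro ⟨z, ⟨-, hx, hxz⟩, -, hy, hyz⟩
    exact ⟨hx.trans hy.symm, near_of_common_shift hxz hyz⟩
  · rintro ⟨ht, h⟩
    obtain ⟨b, hb, hbn, hxb, hyb⟩ := exists_common_shift (pairwise_particlePositions x)
      (pairwise_particlePositions y) (lt_of_mem_particlePositions x)
      (hxy ▸ lt_of_mem_particlePositions y) h
    obtain ⟨z, hz, rfl, hzt⟩ := exists_word (t := particleTypes x) hb hbn (by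
      rw [← hxb.length_eq, length_particlePositions])
    exact ⟨z, ⟨hz, hzt.symm, hxb⟩, hxy ▸ hz, ht ▸ hzt.symm, hyb⟩

theorem binary_shift_confusable_iff {K : ℕ} {S : Channel (Option (Fin 1)) (Option (Fin 1))}
    (hS : IsShiftChannel K S) {x y : List (Option (Fin 1))} (hxy : x.length = y.length) :
    S.Confusable x y ↔ Near K (particlePositions x) (particlePositions y) := by
  rw [shift_confusable_iff hS hxy, and_iff_right_iff_imp]
  intro h
  refine List.ext_getElem ?_ fun _ _ _ => Subsingleton.elim _ _
  rw [← length_particlePositions, ← length_particlePositions]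
  exact List.Forall₂.length_eq h

end Words

/-! ### Zero-error codes of constant weight -/

theorem exists_card_max {α : Type*} [Finite α] {n : ℕ} {p : Finset (List α) → Prop}
    (hp : ∀ C, p C → ∀ x ∈ C, x.length = n) (hex : ∃ C, p C) :
    ∃ C, p C ∧ ∀ D, p D → D.card ≤ C.card := by
  have hfin : {C | p C}.Finite :=
    ((List.finite_length_eq α n).toFinset.powerset.finite_toSet).subset fun C hC => by
      simpa [Set.subset_def] using hp C hC
  obtain ⟨C, hC, hmax⟩ := Set.exists_max_image _ Finset.card hfin hex
  exact ⟨C, hC, hmax⟩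

theorem Channel.exists_isOptimalCode {A B : Type*} [Finite A] [Nonempty A] (ch : Channel A B)
    (n : ℕ) : ∃ C, ch.IsOptimalCode n C := by
  refine exists_card_max (fun C hC => hC.2.1) ?_
  refine ⟨{List.replicate n (Classical.arbitrary A)}, by simp, by simp, ?_⟩
  intro x hx y hy hxy
  simp only [Finset.mem_singleton] at hx hy
  exact absurd (hx.trans hy.symm) hxy

theorem Channel.IsOptimalCode.card_eq {A B : Type*} {ch : Channel A B} {n : ℕ}
    {C D : Finset (List A)} (hC : ch.IsOptimalCode n C) (hD : ch.IsOptimalCode n D) :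
    C.card = D.card :=
  le_antisymm (hD.2 C hC.1) (hC.2 D hD.1)

section Codes

variable {X Y : Type*} {K n w : ℕ}

theorem compress_particlePositions_mem (K : ℕ) {x : List (Option X)} (hx : x.length = n)
    (hw : hammingWeight x = w) : compress K (particlePositions x) ∈
      increasingLists (w + (n - w) / (K + 1)) w := by
  have hpos := pairwise_particlePositions x
  subst hx hw
  rw [hammingWeight_eq_length_particlePositions]
  exact mem_increasingLists.2 ⟨pairwise_compress K hpos, length_compress _ _,
    lt_of_mem_compress K hpos (lt_of_mem_particlePositions x)⟩

/-- The codewords with a given compressed list of positions are pairwise confusable as far as the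
positions go, so their type sequences form a zero-error code for the memoryless channel. -/
theorem card_le_of_isZeroErrorCode_noisyShift {S : Channel (Option X) (Option X)}
    (hS : IsShiftChannel K S) {W : X → PMF Y} {D : Finset (List (Option X))}
    (hD : (noisyShift S W).IsZeroErrorCode n D) (hw : ∀ x ∈ D, hammingWeight x = w)
    {T : Finset (List X)} (hT : (memoryless W).IsOptimalCode w T) :
    D.card ≤ T.card * (w + (n - w) / (K + 1)).choose w := by
  classical
  obtain ⟨-, hlen, hconf⟩ := Channel.isZeroErrorCode_iff.1 hD
  rw [← card_increasingLists]
  refine Finset.card_le_mul_card_image_of_maps_to (f := fun x => compress K (particlePositions x))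
    (fun x hx => compress_particlePositions_mem K (hlen x hx) (hw x hx)) _ fun l _ => ?_
  rcases (D.filter fun x => compress K (particlePositions x) = l).eq_empty_or_nonempty with h | h
  · simp [h]
  have key : ∀ x ∈ D.filter (fun x => compress K (particlePositions x) = l),
      ∀ y ∈ D.filter (fun x => compress K (particlePositions x) = l),
        (memoryless W).Confusable (particleTypes x) (particleTypes y) → x = y := by
    intro x hx y hy hxy
    rw [Finset.mem_filter] at hx hy
    refine hconf x hx.1 y hy.1 ((noisyShift_confusable_iff hS W
      ((hlen x hx.1).trans (hlen y hy.1).symm)).2 ⟨hxy, ?_⟩)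
    exact near_of_compress_eq (pairwise_particlePositions x) (pairwise_particlePositions y)
      (hx.2.trans hy.2.symm)
  -- Every word produces some output, hence is confusable with itself.
  have hrefl : ∀ t, (memoryless W).Confusable t t := fun t =>
    let ⟨z, hz⟩ := ((memoryless W) t).support_nonempty
    ⟨z, hz, hz⟩
  have hinj : Set.InjOn particleTypes
      (D.filter fun x => compress K (particlePositions x) = l : Set (List (Option X))) := by
    intro x hx y hy hxy
    refine key x (by simpa using hx) y (by simpa using hy) ?_
    rw [hxy]
    exact hrefl _
  rw [← Finset.card_image_of_injOn (f := particleTypes) (by simpa using hinj)]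
  refine hT.2 _ (Channel.isZeroErrorCode_iff.2 ⟨h.image _, ?_, ?_⟩)
  · intro t ht
    obtain ⟨x, hx, rfl⟩ := Finset.mem_image.1 ht
    exact hw x (Finset.mem_filter.1 hx).1
  · intro t ht u hu htu
    obtain ⟨x, hx, rfl⟩ := Finset.mem_image.1 ht
    obtain ⟨y, hy, rfl⟩ := Finset.mem_image.1 hu
    rw [key x hx y hy htu]

theorem card_le_of_isZeroErrorCode_shift {S₁ : Channel (Option (Fin 1)) (Option (Fin 1))}
    (hS₁ : IsShiftChannel K S₁) {D : Finset (List (Option (Fin 1)))}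
    (hD : S₁.IsZeroErrorCode n D) (hw : ∀ x ∈ D, hammingWeight x = w) :
    D.card ≤ (w + (n - w) / (K + 1)).choose w := by
  obtain ⟨-, hlen, hconf⟩ := Channel.isZeroErrorCode_iff.1 hD
  rw [← card_increasingLists]
  refine Finset.card_le_card_of_injOn (fun x => compress K (particlePositions x))
    (fun x hx => compress_particlePositions_mem K (hlen x hx) (hw x hx)) fun x hx y hy hxy => ?_
  refine hconf x hx y hy ((binary_shift_confusable_iff hS₁
    ((hlen x hx).trans (hlen y hy).symm)).2 ?_)
  exact near_of_compress_eq (pairwise_particlePositions x) (pairwise_particlePositions y) hxy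

/-- The words whose positions are a stretched list form a zero-error code. -/
theorem exists_isZeroErrorCode_shift {S₁ : Channel (Option (Fin 1)) (Option (Fin 1))}
    (hS₁ : IsShiftChannel K S₁) (hwn : w ≤ n) :
    ∃ C, S₁.IsZeroErrorCode n C ∧ (∀ x ∈ C, hammingWeight x = w) ∧
      C.card = (w + (n - w) / (K + 1)).choose w := by
  classical
  have hex : ∀ l : increasingLists (w + (n - w) / (K + 1)) w, ∃ x : List (Option (Fin 1)),
      x.length = n ∧ particlePositions x = stretch K l := by
    rintro ⟨l, hl⟩
    obtain ⟨h1, h2, h3⟩ := mem_increasingLists.1 hl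
    have hbound : ∀ i ∈ stretch K l, i < n := by
      intro i hi
      have h4 := lt_of_mem_stretch K h1 (by rwa [h2]) i hi
      have h5 := Nat.mul_div_le (n - w) (K + 1)
      omega
    obtain ⟨x, hx1, hx2, -⟩ := exists_word (t := List.replicate (stretch K l).length (0 : Fin 1))
      (pairwise_stretch K h1) hbound (by simp)
    exact ⟨x, hx1, hx2⟩
  choose f hf1 hf2 using hex
  have hnear : ∀ l l', Near K (particlePositions (f l)) (particlePositions (f l')) → l = l' := by
    intro l l' h
    rw [hf2, hf2] at h
    exact Subtype.ext (eq_of_near_stretch (mem_increasingLists.1 l.2).1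
      (mem_increasingLists.1 l'.2).1 h)
  have hinj : Function.Injective f := fun l l' h => hnear l l' (by
    rw [h]
    exact near_iff_getElem.2 ⟨rfl, fun k _ _ => by omega⟩)
  have hcard : (Finset.univ.image f).card = (w + (n - w) / (K + 1)).choose w := by
    rw [Finset.card_image_of_injective _ hinj, Finset.card_univ, Fintype.card_coe,
      card_increasingLists]
  refine ⟨Finset.univ.image f, Channel.isZeroErrorCode_iff.2 ⟨?_, ?_, ?_⟩, ?_, hcard⟩
  · rw [← Finset.card_pos, hcard]
    exact Nat.choose_pos (Nat.le_add_right _ _)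
  · intro x hx
    obtain ⟨l, -, rfl⟩ := Finset.mem_image.1 hx
    exact hf1 l
  · intro x hx y hy hxy
    obtain ⟨l, -, rfl⟩ := Finset.mem_image.1 hx
    obtain ⟨l', -, rfl⟩ := Finset.mem_image.1 hy
    rw [hnear l l' ((binary_shift_confusable_iff hS₁ ((hf1 l).trans (hf1 l').symm)).1 hxy)]
  · intro x hx
    obtain ⟨l, -, rfl⟩ := Finset.mem_image.1 hx
    rw [hammingWeight_eq_length_particlePositions, hf2, length_stretch]
    exact (mem_increasingLists.1 l.2).2.1

theorem exists_isOptimalCodeOfWeight_shift {S₁ : Channel (Option (Fin 1)) (Option (Fin 1))}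
    (hS₁ : IsShiftChannel K S₁) (hwn : w ≤ n) : ∃ I, IsOptimalCodeOfWeight S₁ n w I := by
  obtain ⟨C, hC, hCw, hcard⟩ := exists_isZeroErrorCode_shift hS₁ hwn
  exact ⟨C, ⟨hC, hCw⟩, fun D hD hDw => hcard ▸ card_le_of_isZeroErrorCode_shift hS₁ hD hDw⟩

theorem IsOptimalCodeOfWeight.card_eq {S₁ : Channel (Option (Fin 1)) (Option (Fin 1))}
    (hS₁ : IsShiftChannel K S₁) {I : Finset (List (Option (Fin 1)))}
    (hI : IsOptimalCodeOfWeight S₁ n w I) : I.card = (w + (n - w) / (K + 1)).choose w := by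
  obtain ⟨x, hx⟩ := hI.1.1.1
  have hwn : w ≤ n := by
    rw [← hI.1.2 x hx, ← hI.1.1.2.1 x hx]
    exact hammingWeight_le_length x
  obtain ⟨C, hC, hCw, hcard⟩ := exists_isZeroErrorCode_shift hS₁ hwn
  exact le_antisymm (card_le_of_isZeroErrorCode_shift hS₁ hI.1.1 hI.1.2) (hcard ▸ hI.2 C hC hCw)

theorem mem_productCode [Finite X] {T : Finset (List X)} {I : Finset (List (Option (Fin 1)))}
    {x : List (Option X)} : x ∈ productCode n T I ↔
      x.length = n ∧ particleTypes x ∈ T ∧ indicatorWord x ∈ I := by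
  simp [productCode]

theorem card_productCode [Finite X] {T : Finset (List X)} {I : Finset (List (Option (Fin 1)))}
    (hT : ∀ t ∈ T, t.length = w) (hI : ∀ i ∈ I, i.length = n ∧ hammingWeight i = w) :
    (productCode n T I).card = T.card * I.card := by
  rw [← Finset.card_product]
  refine Finset.card_nbij (fun x => (particleTypes x, indicatorWord x)) ?_ ?_ ?_
  · intro x hx
    simpa using (mem_productCode.1 hx).2
  · intro x hx y hy hxy
    simp only [Prod.mk.injEq] at hxy
    refine word_ext ((mem_productCode.1 hx).1.trans (mem_productCode.1 hy).1.symm) ?_ hxy.1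
    rw [← particlePositions_indicatorWord, hxy.2, particlePositions_indicatorWord]
  · rintro ⟨t, i⟩ hti
    obtain ⟨ht, hi⟩ : t ∈ T ∧ i ∈ I := by simpa using hti
    obtain ⟨h1, h2⟩ := hI i hi
    obtain ⟨x, hx1, hx2, hx3⟩ := exists_word (t := t) (N := n) (pairwise_particlePositions i)
      (h1 ▸ lt_of_mem_particlePositions i)
      (by rw [hT t ht, ← h2, hammingWeight_eq_length_particlePositions])
    have hxi : indicatorWord x = i := binary_word_ext
      ((length_indicatorWord x).trans (hx1.trans h1.symm))
      ((particlePositions_indicatorWord x).trans hx2)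
    exact ⟨x, mem_productCode.2 ⟨hx1, hx3 ▸ ht, hxi ▸ hi⟩, by simp [hx3, hxi]⟩

theorem isZeroErrorCode_productCode [Finite X] {S : Channel (Option X) (Option X)}
    (hS : IsShiftChannel K S) {W : X → PMF Y}
    {S₁ : Channel (Option (Fin 1)) (Option (Fin 1))} (hS₁ : IsShiftChannel K S₁)
    {T : Finset (List X)} {I : Finset (List (Option (Fin 1)))}
    (hT : (memoryless W).IsZeroErrorCode w T) (hI : S₁.IsZeroErrorCode n I)
    (hIw : ∀ x ∈ I, hammingWeight x = w) :
    (noisyShift S W).IsZeroErrorCode n (productCode n T I) := by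
  obtain ⟨hT1, hT2, hT3⟩ := Channel.isZeroErrorCode_iff.1 hT
  obtain ⟨hI1, hI2, hI3⟩ := Channel.isZeroErrorCode_iff.1 hI
  refine Channel.isZeroErrorCode_iff.2 ⟨?_, fun x hx => (mem_productCode.1 hx).1, ?_⟩
  · rw [← Finset.card_pos, card_productCode hT2 fun i hi => ⟨hI2 i hi, hIw i hi⟩]
    exact Nat.mul_pos hT1.card_pos hI1.card_pos
  · intro x hx y hy hxy
    obtain ⟨hxn, hxT, hxI⟩ := mem_productCode.1 hx
    obtain ⟨hyn, hyT, hyI⟩ := mem_productCode.1 hy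
    obtain ⟨h1, h2⟩ := (noisyShift_confusable_iff hS W (hxn.trans hyn.symm)).1 hxy
    have h3 : indicatorWord x = indicatorWord y := hI3 _ hxI _ hyI
      ((binary_shift_confusable_iff hS₁ (by simp only [length_indicatorWord, hxn, hyn])).2
        (by simpa only [particlePositions_indicatorWord] using h2))
    refine word_ext (hxn.trans hyn.symm) ?_ (hT3 _ hxT _ hyT h1)
    rw [← particlePositions_indicatorWord, h3, particlePositions_indicatorWord]

theorem hammingWeight_of_mem_productCode [Finite X] {T : Finset (List X)}
    {I : Finset (List (Option (Fin 1)))} (hIw : ∀ x ∈ I, hammingWeight x = w)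
    {x : List (Option X)} (hx : x ∈ productCode n T I) : hammingWeight x = w := by
  rw [← hammingWeight_indicatorWord]
  exact hIw _ (mem_productCode.1 hx).2.2

theorem isOptimalCodeOfWeight_productCode [Finite X] {S : Channel (Option X) (Option X)}
    (hS : IsShiftChannel K S) {W : X → PMF Y}
    {S₁ : Channel (Option (Fin 1)) (Option (Fin 1))} (hS₁ : IsShiftChannel K S₁)
    {T : Finset (List X)} {I : Finset (List (Option (Fin 1)))}
    (hT : (memoryless W).IsOptimalCode w T) (hI : IsOptimalCodeOfWeight S₁ n w I) :
    IsOptimalCodeOfWeight (noisyShift S W) n w (productCode n T I) := by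
  refine ⟨⟨isZeroErrorCode_productCode hS hS₁ hT.1 hI.1.1 hI.1.2,
    fun x hx => hammingWeight_of_mem_productCode hI.1.2 hx⟩, fun D hD hDw => ?_⟩
  rw [card_productCode hT.1.2.1 fun i hi => ⟨hI.1.1.2.1 i hi, hI.1.2 i hi⟩, hI.card_eq hS₁]
  exact card_le_of_isZeroErrorCode_noisyShift hS hD hDw hT

/-! ### Zero-error codes of all weights -/

variable [Finite X] {S : Channel (Option X) (Option X)} {W : X → PMF Y}
  {S₁ : Channel (Option (Fin 1)) (Option (Fin 1))} {T : ℕ → Finset (List X)}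
  {I : ℕ → Finset (List (Option (Fin 1)))}

theorem card_biUnion_productCode [DecidableEq X] (hS₁ : IsShiftChannel K S₁)
    (h : ∀ w ≤ n, (memoryless W).IsOptimalCode w (T w) ∧ IsOptimalCodeOfWeight S₁ n w (I w)) :
    ((Finset.range (n + 1)).biUnion fun w => productCode n (T w) (I w)).card =
      ∑ w ∈ Finset.range (n + 1), (T w).card * (w + (n - w) / (K + 1)).choose w := by
  rw [Finset.card_biUnion]
  · refine Finset.sum_congr rfl fun w hw => ?_
    obtain ⟨hT, hI⟩ := h w (Nat.lt_succ_iff.1 (Finset.mem_range.1 hw))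
    rw [card_productCode hT.1.2.1 fun i hi => ⟨hI.1.1.2.1 i hi, hI.1.2 i hi⟩, hI.card_eq hS₁]
  · intro v hv w hw hvw
    refine Finset.disjoint_left.2 fun x hx hx' => hvw ?_
    rw [← hammingWeight_of_mem_productCode
      (h v (Nat.lt_succ_iff.1 (Finset.mem_range.1 hv))).2.1.2 hx]
    exact hammingWeight_of_mem_productCode
      (h w (Nat.lt_succ_iff.1 (Finset.mem_range.1 hw))).2.1.2 hx'

theorem isOptimalCode_biUnion_productCode [DecidableEq X] (hS : IsShiftChannel K S)
    (hS₁ : IsShiftChannel K S₁)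
    (h : ∀ w ≤ n, (memoryless W).IsOptimalCode w (T w) ∧ IsOptimalCodeOfWeight S₁ n w (I w)) :
    (noisyShift S W).IsOptimalCode n
      ((Finset.range (n + 1)).biUnion fun w => productCode n (T w) (I w)) := by
  have hzero : ∀ w ∈ Finset.range (n + 1),
      (noisyShift S W).IsZeroErrorCode n (productCode n (T w) (I w)) := fun w hw =>
    let ⟨hT, hI⟩ := h w (Nat.lt_succ_iff.1 (Finset.mem_range.1 hw))
    isZeroErrorCode_productCode hS hS₁ hT.1 hI.1.1 hI.1.2
  refine ⟨Channel.isZeroErrorCode_iff.2 ⟨?_, ?_, ?_⟩, fun D hD => ?_⟩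
  · have h0 : 0 ∈ Finset.range (n + 1) := by simp
    exact (hzero 0 h0).1.mono (Finset.subset_biUnion_of_mem
      (fun w => productCode n (T w) (I w)) h0)
  · intro x hx
    obtain ⟨w, -, hx⟩ := Finset.mem_biUnion.1 hx
    exact (mem_productCode.1 hx).1
  · intro x hx y hy hxy
    obtain ⟨v, hv, hx⟩ := Finset.mem_biUnion.1 hx
    obtain ⟨w, hw, hy⟩ := Finset.mem_biUnion.1 hy
    have hlen := (mem_productCode.1 hx).1.trans (mem_productCode.1 hy).1.symm
    -- The channel preserves the weight, so words of different weights are never confusable.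
    obtain rfl : v = w := by
      rw [← hammingWeight_of_mem_productCode
          (h v (Nat.lt_succ_iff.1 (Finset.mem_range.1 hv))).2.1.2 hx,
        ← hammingWeight_of_mem_productCode
          (h w (Nat.lt_succ_iff.1 (Finset.mem_range.1 hw))).2.1.2 hy,
        hammingWeight_eq_length_particlePositions, hammingWeight_eq_length_particlePositions]
      exact ((noisyShift_confusable_iff hS W hlen).1 hxy).2.length_eq
    exact (Channel.isZeroErrorCode_iff.1 (hzero v hv)).2.2 x hx y hy hxy
  · rw [card_biUnion_productCode hS₁ h]
    have hmaps : ∀ x ∈ D, hammingWeight x ∈ Finset.range (n + 1) := fun x hx => by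
      have := hammingWeight_le_length x
      rw [hD.2.1 x hx] at this
      exact Finset.mem_range.2 (Nat.lt_succ_of_le this)
    rw [Finset.card_eq_sum_card_fiberwise hmaps]
    refine Finset.sum_le_sum fun w hw => ?_
    rcases (D.filter fun x => hammingWeight x = w).eq_empty_or_nonempty with h0 | h0
    · simp [h0]
    · refine card_le_of_isZeroErrorCode_noisyShift hS ⟨h0, ?_, ?_⟩
        (fun x hx => (Finset.mem_filter.1 hx).2)
        (h w (Nat.lt_succ_iff.1 (Finset.mem_range.1 hw))).1
      · exact fun x hx => hD.2.1 x (Finset.mem_filter.1 hx).1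
      · exact fun x hx y hy => hD.2.2 x (Finset.mem_filter.1 hx).1 y (Finset.mem_filter.1 hy).1

end Codes

/-! ### Rates of codes and concatenation -/

namespace Channel

variable {A B : Type*} {ch : Channel A B}

theorem rate_eq_of_length {k n : ℕ} (hlen : ∀ x z, ch.Produces x z → z.length = x.length + k)
    {C : Finset (List A)} (hC : ch.IsZeroErrorCode n C) :
    ch.rate C = Real.logb 2 C.card / (n + k : ℕ) := by
  have h1 : ∀ x ∈ C, ∑' z : List B, (z.length : ℝ≥0∞) * ch x z = (n + k : ℕ) := by
    intro x hx
    have h2 : ∀ z : List B, (z.length : ℝ≥0∞) * ch x z = (n + k : ℕ) * ch x z := by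
      intro z
      by_cases hz : ch x z = 0
      · simp [hz]
      · rw [hlen x z ((PMF.mem_support_iff _ _).2 hz), hC.2.1 x hx]
    simp only [h2, ENNReal.tsum_mul_left, PMF.tsum_coe, mul_one]
  have hcard : (C.card : ℝ≥0∞) ≠ 0 := by exact_mod_cast hC.1.card_pos.ne'
  rw [rate, avgOutputLength, Finset.sum_congr rfl h1, Finset.sum_const, nsmul_eq_mul,
    mul_comm, ENNReal.mul_div_cancel_right hcard (ENNReal.natCast_ne_top _),
    ENNReal.toReal_natCast]

theorem zeroErrorCapacity_eq_limsup {k : ℕ}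
    (hlen : ∀ x z, ch.Produces x z → z.length = x.length + k)
    {C : ℕ → Finset (List A)} (hC : ∀ n, ch.IsOptimalCode n (C n)) :
    ch.zeroErrorCapacity =
      limsup (fun n : ℕ => ((Real.logb 2 (C n).card / (n + k : ℕ) : ℝ) : EReal)) atTop := by
  unfold zeroErrorCapacity
  congr 1
  ext n
  refine le_antisymm (iSup₂_le fun D hD => ?_) ?_
  · rw [rate_eq_of_length hlen hD.1, hD.card_eq (hC n)]
  · exact le_iSup₂_of_le (C n) (hC n) (by rw [rate_eq_of_length hlen (hC n).1])

end Channel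

section Memoryless

variable {A B : Type*} {W : A → PMF B}

theorem length_of_memoryless_produces {x : List A} {z : List B}
    (h : (memoryless W).Produces x z) : z.length = x.length :=
  ((memoryless_produces_iff W x z).1 h).length_eq.symm

/-- All concatenations of a codeword of `C` and a codeword of `D` form a zero-error code. -/
theorem card_mul_card_le {m n : ℕ} {C D E : Finset (List A)}
    (hC : (memoryless W).IsZeroErrorCode m C) (hD : (memoryless W).IsZeroErrorCode n D)
    (hE : (memoryless W).IsOptimalCode (m + n) E) : C.card * D.card ≤ E.card := by
  classical
  obtain ⟨hC1, hC2, hC3⟩ := Channel.isZeroErrorCode_iff.1 hC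
  obtain ⟨hD1, hD2, hD3⟩ := Channel.isZeroErrorCode_iff.1 hD
  have hinj : Set.InjOn (fun p : List A × List A => p.1 ++ p.2) (C ×ˢ D : Finset _) := by
    rintro ⟨x, y⟩ hxy ⟨x', y'⟩ hxy' h
    simp only [Finset.coe_product, Set.mem_prod, Finset.mem_coe] at hxy hxy'
    obtain ⟨h1, h2⟩ := List.append_inj h ((hC2 x hxy.1).trans (hC2 x' hxy'.1).symm)
    exact Prod.ext h1 h2
  rw [← Finset.card_product, ← Finset.card_image_of_injOn hinj]
  refine hE.2 _ (Channel.isZeroErrorCode_iff.2 ⟨(hC1.product hD1).image _, ?_, ?_⟩)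
  · intro x hx
    obtain ⟨⟨x, y⟩, hxy, rfl⟩ := Finset.mem_image.1 hx
    obtain ⟨hx, hy⟩ := Finset.mem_product.1 hxy
    simp [hC2 x hx, hD2 y hy]
  · intro x hx x' hx' hconf
    obtain ⟨⟨x, y⟩, hxy, rfl⟩ := Finset.mem_image.1 hx
    obtain ⟨⟨x', y'⟩, hxy', rfl⟩ := Finset.mem_image.1 hx'
    obtain ⟨hx, hy⟩ := Finset.mem_product.1 hxy
    obtain ⟨hx', hy'⟩ := Finset.mem_product.1 hxy'
    obtain ⟨z, hz, hz'⟩ := hconf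
    rw [memoryless_produces_iff] at hz hz'
    have h1 := List.forall₂_take m hz
    have h2 := List.forall₂_drop m hz
    have h1' := List.forall₂_take m hz'
    have h2' := List.forall₂_drop m hz'
    simp only [List.take_left' (hC2 x hx), List.drop_left' (hC2 x hx),
      List.take_left' (hC2 x' hx'), List.drop_left' (hC2 x' hx')] at h1 h2 h1' h2'
    rw [hC3 x hx x' hx' ⟨_, (memoryless_produces_iff _ _ _).2 h1,
        (memoryless_produces_iff _ _ _).2 h1'⟩,
      hD3 y hy y' hy' ⟨_, (memoryless_produces_iff _ _ _).2 h2,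
        (memoryless_produces_iff _ _ _).2 h2'⟩]

end Memoryless

/-! ### The characteristic equation -/

section Growth

variable {K : ℕ}

theorem characteristic_eq_iff {c s : ℝ} (hs : 0 < s) :
    s ^ (K + 1) - c * s ^ K - 1 = 0 ↔ s - (s ^ K)⁻¹ = c := by
  have h : s ^ K ≠ 0 := (pow_pos hs K).ne'
  have h1 : s ^ (K + 1) - c * s ^ K - 1 = s ^ K * (s - (s ^ K)⁻¹ - c) := by
    rw [pow_succ, mul_sub, mul_sub, mul_inv_cancel₀ h]
    ring
  rw [h1, mul_eq_zero, or_iff_right h, sub_eq_zero]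

theorem sub_inv_pow_lt {s t : ℝ} (hs : 0 < s) (hst : s < t) :
    s - (s ^ K)⁻¹ < t - (t ^ K)⁻¹ := by
  have h : (t ^ K)⁻¹ ≤ (s ^ K)⁻¹ :=
    inv_anti₀ (pow_pos hs K) (pow_le_pow_left₀ hs.le hst.le K)
  linarith

theorem exists_characteristic_root (K : ℕ) {c : ℝ} (hc : 0 < c) :
    ∃ r : ℝ, 0 < r ∧ r ^ (K + 1) - c * r ^ K - 1 = 0 := by
  have hcont : ContinuousOn (fun x : ℝ => x ^ (K + 1) - c * x ^ K - 1) (Set.Icc 1 (c + 1)) := by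
    fun_prop
  have h0 : (0 : ℝ) ∈ Set.Icc ((1 : ℝ) ^ (K + 1) - c * 1 ^ K - 1)
      ((c + 1) ^ (K + 1) - c * (c + 1) ^ K - 1) := by
    constructor
    · simp only [one_pow]
      linarith
    · have : (1 : ℝ) ≤ (c + 1) ^ K := one_le_pow₀ (by linarith)
      rw [pow_succ]
      linarith
  obtain ⟨r, hr, h⟩ := intermediate_value_Icc (by linarith) hcont h0
  exact ⟨r, by linarith [hr.1], h⟩

theorem one_lt_of_characteristic_eq {c r : ℝ} (hc : 0 < c) (hr : 0 < r)
    (h : r - (r ^ K)⁻¹ = c) : 1 < r := by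
  by_contra! h1
  have : 1 ≤ (r ^ K)⁻¹ := (one_le_inv₀ (pow_pos hr K)).2 (pow_le_one₀ hr.le h1)
  linarith

/-- The numbers `(s - s⁻ᴷ) / s` and `s⁻ᴷ⁻¹` add up to `1`, so their powers weighted with the
binomial coefficients do, too. -/
theorem sum_choose_mul_div_eq_one (K : ℕ) {s : ℝ} (hs : 0 < s) (N : ℕ) :
    ∑ w ∈ Finset.range (N + 1),
      (N.choose w * (s - (s ^ K)⁻¹) ^ w) / s ^ (w + (K + 1) * (N - w)) = 1 := by
  have h1 : (s - (s ^ K)⁻¹) / s + (s ^ (K + 1))⁻¹ = 1 := by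
    field_simp
    ring
  have h2 := add_pow ((s - (s ^ K)⁻¹) / s) ((s ^ (K + 1))⁻¹) N
  rw [h1, one_pow] at h2
  rw [h2]
  refine Finset.sum_congr rfl fun w _ => ?_
  rw [pow_add, pow_mul, div_pow, inv_pow]
  have := pow_pos hs w
  have := pow_pos (pow_pos hs (K + 1)) (N - w)
  field_simp

theorem choose_mul_pow_le {s : ℝ} (hs : 1 ≤ s) (w m : ℕ) :
    ((w + m).choose w : ℝ) * (s - (s ^ K)⁻¹) ^ w ≤ s ^ (w + (K + 1) * m) := by
  have hs0 : 0 < s := by linarith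
  have hc : 0 ≤ s - (s ^ K)⁻¹ := by
    have : (s ^ K)⁻¹ ≤ 1 := inv_le_one_of_one_le₀ (one_le_pow₀ hs)
    linarith
  rw [← div_le_one (pow_pos hs0 _), ← sum_choose_mul_div_eq_one K hs0 (w + m)]
  have := Finset.single_le_sum (s := Finset.range (w + m + 1))
    (f := fun v => (((w + m).choose v : ℝ) * (s - (s ^ K)⁻¹) ^ v) /
      s ^ (v + (K + 1) * (w + m - v))) (fun v _ => by positivity)
    (show w ∈ Finset.range (w + m + 1) by simp)
  simpa using this

/-- One of the `N + 1` summands of `sum_choose_mul_div_eq_one` is at least their average. -/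
theorem exists_le_choose_mul_pow (K : ℕ) {s : ℝ} (hs : 0 < s) (N : ℕ) : ∃ w ≤ N,
    s ^ (w + (K + 1) * (N - w)) / (N + 1) ≤ N.choose w * (s - (s ^ K)⁻¹) ^ w := by
  obtain ⟨w, hw, h⟩ := Finset.exists_le_of_sum_le (s := Finset.range (N + 1))
    (f := fun _ => 1 / ((N : ℝ) + 1))
    (g := fun w => (N.choose w * (s - (s ^ K)⁻¹) ^ w) / s ^ (w + (K + 1) * (N - w)))
    (by simp) (by
      rw [sum_choose_mul_div_eq_one K hs N, Finset.sum_const, Finset.card_range, nsmul_eq_mul]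
      push_cast
      rw [mul_one_div_cancel (by positivity)])
  refine ⟨w, Nat.lt_succ_iff.1 (Finset.mem_range.1 hw), ?_⟩
  rw [le_div_iff₀ (pow_pos hs _)] at h
  rwa [div_eq_mul_one_div, mul_comm]

/-! ### Exponential growth rates -/

/-- A linear factor is absorbed by an arbitrarily small increase of the base of an exponential. -/
theorem eventually_linear_mul_pow_le (C : ℝ) {s t : ℝ} (hs : 0 < s) (hst : s < t) :
    ∀ᶠ n : ℕ in atTop, C * (n + 1) * s ^ n ≤ t ^ n := by
  have ht : 0 < t := hs.trans hst
  have h1 : Tendsto (fun n : ℕ => C * ((n : ℝ) * (s / t) ^ n + (s / t) ^ n)) atTop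
      (nhds (C * (0 + 0))) :=
    ((tendsto_self_mul_const_pow_of_lt_one (by positivity) ((div_lt_one ht).2 hst)).add
      (tendsto_pow_atTop_nhds_zero_of_lt_one (by positivity) ((div_lt_one ht).2 hst))).const_mul C
  rw [add_zero, mul_zero] at h1
  filter_upwards [h1.eventually (gt_mem_nhds zero_lt_one)] with n hn
  rw [← div_le_one (pow_pos ht n)]
  refine le_trans (le_of_eq ?_) hn.le
  rw [div_pow]
  ring

theorem exists_le_mul_pow_of_limsup_lt {a : ℕ → ℕ} (ha : ∀ n, 1 ≤ a n) {b : ℝ} (hb : 0 < b)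
    (h : limsup (fun n : ℕ => ((Real.logb 2 (a n) / n : ℝ) : EReal)) atTop <
      (Real.logb 2 b : ℝ)) :
    ∃ D : ℝ, 0 < D ∧ ∀ n, (a n : ℝ) ≤ D * b ^ n := by
  have h1 : ∀ᶠ n : ℕ in atTop, (a n : ℝ) ≤ b ^ n := by
    filter_upwards [eventually_lt_of_limsup_lt h, eventually_gt_atTop 0] with n hn hn0
    have hn0' : (0 : ℝ) < n := by exact_mod_cast hn0
    rw [EReal.coe_lt_coe_iff, div_lt_iff₀ hn0', mul_comm, ← Real.logb_pow] at hn
    exact ((Real.logb_lt_logb_iff one_lt_two (by exact_mod_cast ha n) (pow_pos hb n)).1 hn).le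
  obtain ⟨N, hN⟩ := eventually_atTop.1 h1
  have hsum : ∀ i, (0 : ℝ) ≤ a i / b ^ i := fun i => by positivity
  have hD : (0 : ℝ) ≤ ∑ i ∈ Finset.range N, a i / b ^ i := Finset.sum_nonneg fun i _ => hsum i
  -- The sum takes care of the finitely many terms before the bound `b ^ n` sets in.
  refine ⟨1 + ∑ i ∈ Finset.range N, a i / b ^ i, by linarith, fun n => ?_⟩
  rw [← div_le_iff₀ (pow_pos hb n)]
  rcases lt_or_ge n N with hn | hn
  · have := Finset.single_le_sum (fun i _ => hsum i) (Finset.mem_range.2 hn)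
    linarith
  · have := (div_le_one (pow_pos hb n)).2 (hN n hn)
    linarith

/-- For a supermultiplicative sequence, one large term makes all later terms large. -/
theorem exists_mul_pow_le_of_lt_limsup {a : ℕ → ℕ} (ha : ∀ n, 1 ≤ a n)
    (hmul : ∀ m n, a m * a n ≤ a (m + n)) {b : ℝ} (hb : 0 < b)
    (h : (Real.logb 2 b : ℝ) <
      limsup (fun n : ℕ => ((Real.logb 2 (a n) / n : ℝ) : EReal)) atTop) :
    ∃ d : ℝ, 0 < d ∧ ∀ n, d * b ^ n ≤ (a n : ℝ) := by
  obtain ⟨q, hq, hq0⟩ := ((frequently_lt_of_lt_limsup (by isBoundedDefault) h).and_eventually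
    (eventually_gt_atTop 0)).exists
  have hq0' : (0 : ℝ) < q := by exact_mod_cast hq0
  rw [EReal.coe_lt_coe_iff, lt_div_iff₀ hq0', mul_comm, ← Real.logb_pow] at hq
  have hbq : b ^ q ≤ a q :=
    ((Real.logb_lt_logb_iff one_lt_two (pow_pos hb q) (by exact_mod_cast ha q)).1 hq).le
  have hpow : ∀ k, a q ^ k ≤ a (q * k) := by
    intro k
    induction k with
    | zero => simpa using ha 0
    | succ k ih =>
      rw [pow_succ, Nat.mul_succ]
      exact (Nat.mul_le_mul_right _ ih).trans (hmul _ _)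
  have hB : 0 < max 1 b ^ q := pow_pos (lt_max_of_lt_left one_pos) q
  refine ⟨(max 1 b ^ q)⁻¹, inv_pos.2 hB, fun n => ?_⟩
  rw [inv_mul_le_iff₀ hB]
  have h1 : a q ^ (n / q) ≤ a n := by
    calc a q ^ (n / q) ≤ a (q * (n / q)) * a (n % q) :=
          (hpow _).trans (Nat.le_mul_of_pos_right _ (ha _))
      _ ≤ a n := by simpa only [Nat.div_add_mod] using hmul (q * (n / q)) (n % q)
  have h2 : b ^ (n % q) ≤ max 1 b ^ q :=
    (pow_le_pow_left₀ hb.le (le_max_right 1 b) _).trans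
      (pow_le_pow_right₀ (le_max_left 1 b) (Nat.mod_lt n hq0).le)
  calc b ^ n = b ^ (n % q) * (b ^ q) ^ (n / q) := by
        rw [← pow_mul, ← pow_add, Nat.mod_add_div]
    _ ≤ max 1 b ^ q * (a q : ℝ) ^ (n / q) := by gcongr
    _ ≤ max 1 b ^ q * a n := by
        gcongr
        exact_mod_cast h1

/-- The cardinality of a union over `w ≤ n` of products of codes with `a w` words and codes with
`(w + ⌊(n - w) / (K + 1)⌋).choose w` words. -/
def productUnionCard (K : ℕ) (a : ℕ → ℕ) (n : ℕ) : ℕ :=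
  ∑ w ∈ Finset.range (n + 1), a w * (w + (n - w) / (K + 1)).choose w

theorem one_le_productUnionCard {a : ℕ → ℕ} (ha : ∀ n, 1 ≤ a n) (n : ℕ) :
    1 ≤ productUnionCard K a n := by
  have h := Finset.single_le_sum
    (f := fun w => a w * (w + (n - w) / (K + 1)).choose w) (fun w _ => Nat.zero_le _)
    (show 0 ∈ Finset.range (n + 1) by simp)
  refine le_trans ?_ h
  simpa using ha 0

theorem productUnionCard_le {a : ℕ → ℕ} {s D : ℝ} (hs : 1 ≤ s) (hD : 0 < D)
    (ha : ∀ n, (a n : ℝ) ≤ D * (s - (s ^ K)⁻¹) ^ n) (n : ℕ) :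
    (productUnionCard K a n : ℝ) ≤ D * (n + 1) * s ^ n := by
  have h1 : ∀ w ∈ Finset.range (n + 1),
      ((a w * (w + (n - w) / (K + 1)).choose w : ℕ) : ℝ) ≤ D * s ^ n := by
    intro w hw
    have hwn : w ≤ n := Nat.lt_succ_iff.1 (Finset.mem_range.1 hw)
    push_cast
    calc (a w : ℝ) * (w + (n - w) / (K + 1)).choose w
        ≤ D * (s - (s ^ K)⁻¹) ^ w * (w + (n - w) / (K + 1)).choose w := by
          gcongr
          exact ha w
      _ = D * ((w + (n - w) / (K + 1)).choose w * (s - (s ^ K)⁻¹) ^ w) := by ring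
      _ ≤ D * s ^ (w + (K + 1) * ((n - w) / (K + 1))) := by
          gcongr
          exact choose_mul_pow_le hs _ _
      _ ≤ D * s ^ n := by
          have := Nat.mul_div_le (n - w) (K + 1)
          gcongr
          omega
  rw [productUnionCard, Nat.cast_sum]
  refine (Finset.sum_le_card_nsmul _ _ _ h1).trans (le_of_eq ?_)
  rw [Finset.card_range, nsmul_eq_mul]
  push_cast
  ring

/-- The single term with `w` ones among `N` letters, each of the other `N - w` letters being
stretched to `K + 1` empty cells, is large enough in the length `n = w + (K + 1) * (N - w)`. -/
theorem frequently_le_productUnionCard {a : ℕ → ℕ} {s d : ℝ} (hs : 1 ≤ s) (hd : 0 < d)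
    (ha : ∀ n, d * (s - (s ^ K)⁻¹) ^ n ≤ (a n : ℝ)) :
    ∃ᶠ n : ℕ in atTop, d * s ^ n / (n + 1) ≤ (productUnionCard K a n : ℝ) := by
  refine frequently_atTop.2 fun N => ?_
  obtain ⟨w, hw, h⟩ := exists_le_choose_mul_pow K (by linarith : 0 < s) N
  have hmul : N - w ≤ (K + 1) * (N - w) := Nat.le_mul_of_pos_left _ K.succ_pos
  have hN : N ≤ w + (K + 1) * (N - w) := by omega
  refine ⟨w + (K + 1) * (N - w), hN, ?_⟩
  set n := w + (K + 1) * (N - w) with hn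
  have hterm : a w * N.choose w ≤ productUnionCard K a n := by
    have h1 := Finset.single_le_sum
      (f := fun w => a w * (w + (n - w) / (K + 1)).choose w) (fun w _ => Nat.zero_le _)
      (show w ∈ Finset.range (n + 1) from Finset.mem_range.2 (by omega))
    have h2 : w + (n - w) / (K + 1) = N := by
      rw [hn, Nat.add_sub_cancel_left, Nat.mul_div_cancel_left _ K.succ_pos]
      omega
    simp only [h2] at h1
    exact h1
  have hNn : (N : ℝ) ≤ n := by exact_mod_cast hN
  calc d * s ^ n / (n + 1) ≤ d * s ^ n / (N + 1) := by gcongr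
    _ = d * (s ^ n / (N + 1)) := by ring
    _ ≤ d * (N.choose w * (s - (s ^ K)⁻¹) ^ w) := by gcongr
    _ = d * (s - (s ^ K)⁻¹) ^ w * N.choose w := by ring
    _ ≤ a w * N.choose w := by
        gcongr
        exact ha w
    _ ≤ productUnionCard K a n := by exact_mod_cast hterm

theorem limsup_productUnionCard {a : ℕ → ℕ} (ha : ∀ n, 1 ≤ a n)
    (hmul : ∀ m n, a m * a n ≤ a (m + n)) {C₀ r : ℝ} (hr : 0 < r)
    (hroot : r ^ (K + 1) - (2 : ℝ) ^ C₀ * r ^ K - 1 = 0)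
    (hlim : limsup (fun n : ℕ => ((Real.logb 2 (a n) / n : ℝ) : EReal)) atTop = C₀) :
    limsup (fun n : ℕ => ((Real.logb 2 (productUnionCard K a n) / (n + K : ℕ) : ℝ) : EReal))
      atTop = (Real.logb 2 r : ℝ) := by
  have hc : (0 : ℝ) < 2 ^ C₀ := by positivity
  have hroot' := (characteristic_eq_iff hr).1 hroot
  have hr1 : 1 < r := one_lt_of_characteristic_eq hc hr hroot'
  have hlogc : Real.logb 2 ((2 : ℝ) ^ C₀) = C₀ := Real.logb_rpow (by norm_num) (by norm_num)
  apply le_antisymm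
  · refine EReal.le_of_forall_lt_iff_le.1 fun t ht => ?_
    rw [EReal.coe_lt_coe_iff, Real.logb_lt_iff_lt_rpow one_lt_two hr] at ht
    obtain ⟨s, hrs, hst⟩ := exists_between ht
    have hs : 1 < s := hr1.trans hrs
    have hcs : (2 : ℝ) ^ C₀ < s - (s ^ K)⁻¹ := hroot' ▸ sub_inv_pow_lt hr hrs
    obtain ⟨D, hD, hbound⟩ := exists_le_mul_pow_of_limsup_lt ha (hc.trans hcs) (by
      rw [hlim, EReal.coe_lt_coe_iff, ← hlogc]
      rwa [hlogc, Real.lt_logb_iff_rpow_lt one_lt_two (hc.trans hcs)])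
    refine limsup_le_of_le (by isBoundedDefault) ?_
    filter_upwards [eventually_linear_mul_pow_le D (by linarith) hst, eventually_gt_atTop 0]
      with n hn hn0
    have h1 := (productUnionCard_le hs.le hD hbound n).trans hn
    have hpos : (0 : ℝ) < productUnionCard K a n := by
      exact_mod_cast one_le_productUnionCard ha n
    have h2 := Real.logb_le_logb_of_le one_lt_two hpos h1
    rw [Real.logb_pow, Real.logb_rpow (by norm_num) (by norm_num)] at h2
    have ht0 : 0 ≤ t := by
      by_contra! h
      linarith [Real.rpow_lt_one_of_one_lt_of_neg one_lt_two h]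
    rw [EReal.coe_le_coe_iff, div_le_iff₀ (by positivity)]
    push_cast
    nlinarith [(Nat.cast_nonneg K : (0 : ℝ) ≤ K)]
  · refine EReal.ge_of_forall_gt_iff_ge.1 fun t ht => ?_
    rw [EReal.coe_lt_coe_iff, Real.lt_logb_iff_rpow_lt one_lt_two hr] at ht
    obtain ⟨u, hu, hur⟩ := exists_between (max_lt ht hr1)
    obtain ⟨s, hus, hsr⟩ := exists_between hur
    have hu1 : 1 < u := (le_max_right _ _).trans_lt hu
    have hs : 1 < s := hu1.trans hus
    have hcs : s - (s ^ K)⁻¹ < 2 ^ C₀ := hroot' ▸ sub_inv_pow_lt (by linarith) hsr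
    have hs0 : 0 < s - (s ^ K)⁻¹ := by
      have := sub_inv_pow_lt (K := K) one_pos hs
      simpa using this
    obtain ⟨d, hd, hbound⟩ := exists_mul_pow_le_of_lt_limsup ha hmul hs0 (by
      rwa [hlim, EReal.coe_lt_coe_iff, Real.logb_lt_iff_lt_rpow one_lt_two hs0])
    refine le_limsup_of_frequently_le ?_ (by isBoundedDefault)
    -- The factor `u ^ K` makes up for the `K` cells by which the output is longer.
    refine ((frequently_le_productUnionCard hs.le hd hbound).and_eventually
      ((eventually_linear_mul_pow_le (u ^ K / d) (by linarith) hus).and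
        (eventually_gt_atTop 0))).mono ?_
    rintro n ⟨h1, h2, hn0⟩
    have h3 : u ^ (n + K) ≤ productUnionCard K a n := by
      refine le_trans ?_ h1
      rw [le_div_iff₀ (by positivity)]
      calc u ^ (n + K) * (n + 1) = d * (u ^ K / d * (n + 1) * u ^ n) := by
            rw [pow_add]
            field_simp
        _ ≤ d * s ^ n := by gcongr
    have h4 := Real.logb_le_logb_of_le one_lt_two (by positivity) h3
    rw [Real.logb_pow] at h4
    have h5 : t ≤ Real.logb 2 u :=
      ((Real.lt_logb_iff_rpow_lt one_lt_two (by linarith)).2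
        ((le_max_left _ _).trans_lt hu)).le
    rw [EReal.coe_le_coe_iff, le_div_iff₀ (by positivity), mul_comm]
    exact le_trans (by gcongr) h4

end Growth

/-! ### The noisy shift channel -/

theorem zeroErrorCapacity_noisyShift {X Y : Type*} [Finite X] [Nonempty X] {K : ℕ}
    {S : Channel (Option X) (Option X)} (hS : IsShiftChannel K S) {W : X → PMF Y}
    {S₁ : Channel (Option (Fin 1)) (Option (Fin 1))} (hS₁ : IsShiftChannel K S₁) {C₀ r : ℝ}
    (hC₀ : (memoryless W).zeroErrorCapacity = (C₀ : EReal)) (hr : 0 < r)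
    (hroot : r ^ (K + 1) - (2 : ℝ) ^ C₀ * r ^ K - 1 = 0) :
    (noisyShift S W).zeroErrorCapacity = ((Real.logb 2 r : ℝ) : EReal) := by
  classical
  choose T hT using (memoryless W).exists_isOptimalCode
  have hI : ∀ n w, ∃ I, w ≤ n → IsOptimalCodeOfWeight S₁ n w I := fun n w => by
    by_cases hw : w ≤ n
    · obtain ⟨I, hI⟩ := exists_isOptimalCodeOfWeight_shift hS₁ hw
      exact ⟨I, fun _ => hI⟩
    · exact ⟨∅, fun h => absurd h hw⟩
  choose I hI using hI
  have hTI : ∀ n, ∀ w ≤ n, (memoryless W).IsOptimalCode w (T w) ∧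
      IsOptimalCodeOfWeight S₁ n w (I n w) := fun n w hw => ⟨hT w, hI n w hw⟩
  rw [Channel.zeroErrorCapacity_eq_limsup (k := 0)
    (fun x z h => length_of_memoryless_produces h) hT] at hC₀
  rw [Channel.zeroErrorCapacity_eq_limsup
    (fun x z h => ((noisyShift_produces_iff hS W x z).1 h).1)
    (fun n => isOptimalCode_biUnion_productCode hS hS₁ (hTI n))]
  simp only [fun n => card_biUnion_productCode (W := W) hS₁ (hTI n)]
  exact limsup_productUnionCard (fun n => (hT n).1.1.card_pos)
    (fun m n => card_mul_card_le (hT m).1 (hT n).1 (hT (m + n))) hr hroot hC₀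

theorem mainTheorem5 (P K : ℕ) (hP : 1 ≤ P) {Y : Type*} (W : Fin P → PMF Y) (C₀ : ℝ)
    (hC₀ : (memoryless W).zeroErrorCapacity = (C₀ : EReal))
    (S : Channel (Option (Fin P)) (Option (Fin P))) (hS : IsShiftChannel K S)
    (S₁ : Channel (Option (Fin 1)) (Option (Fin 1))) (hS₁ : IsShiftChannel K S₁) :
    -- the capacity
    (∃ r : ℝ, (0 < r ∧ r ^ (K + 1) - (2 : ℝ) ^ C₀ * r ^ K - 1 = 0) ∧
      (∀ y : ℝ, 0 < y → y ^ (K + 1) - (2 : ℝ) ^ C₀ * y ^ K - 1 = 0 → y = r) ∧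
      (noisyShift S W).zeroErrorCapacity = ((Real.logb 2 r : ℝ) : EReal)) ∧
    -- optimal codes of length `n` and weight `w`
    (∀ (n w : ℕ) (T : Finset (List (Fin P))) (I : Finset (List (Option (Fin 1)))),
      (memoryless W).IsOptimalCode w T → IsOptimalCodeOfWeight S₁ n w I →
      IsOptimalCodeOfWeight (noisyShift S W) n w (productCode n T I)) ∧
    -- optimal codes of length `n`
    (∀ (n : ℕ) (T : ℕ → Finset (List (Fin P))) (I : ℕ → Finset (List (Option (Fin 1)))),
      (∀ w ≤ n, (memoryless W).IsOptimalCode w (T w) ∧ IsOptimalCodeOfWeight S₁ n w (I w)) →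
      (noisyShift S W).IsOptimalCode n
        ((Finset.range (n + 1)).biUnion fun w => productCode n (T w) (I w))) := by
  refine ⟨?_, fun n w T I hT hI => isOptimalCodeOfWeight_productCode hS hS₁ hT hI,
    fun n T I h => isOptimalCode_biUnion_productCode hS hS₁ h⟩
  have : Nonempty (Fin P) := ⟨⟨0, hP⟩⟩
  obtain ⟨r, hr, hroot⟩ := exists_characteristic_root K (Real.rpow_pos_of_pos two_pos C₀)
  refine ⟨r, ⟨hr, hroot⟩, fun y hy hyroot => ?_, zeroErrorCapacity_noisyShift hS hS₁ hC₀ hr hroot⟩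
  rw [characteristic_eq_iff hr] at hroot
  rw [characteristic_eq_iff hy] at hyroot
  rcases lt_trichotomy y r with h | h | h
  · exact absurd (hyroot.trans hroot.symm) (sub_inv_pow_lt hy h).ne
  · exact h
  · exact absurd (hroot.trans hyroot.symm) (sub_inv_pow_lt hr h).ne
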